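/- **Theorem 1 (k-trip cumulative lower bound).** A *scene* is a set $S$ of axis-parallel rectangular obstacles in the plane with pairwise disjoint interiors (they may touch), each of width and height at least $1$ and with integral $x$-coordinates of its corners, such that the start point $s=(0,0)$ is in the interior of none of them. The target is the wall, i.e. the line $x=n$. A point robot may be anywhere outside the interiors of the obstacles (so it can squeeze between touching obstacles). It does not know the scene; it discovers an obstacle only when it touches it (it may then be told the whole obstacle). A *deterministic algorithm* $R$ for $k$ trips prescribes, in every scene $S$, a continuous motion of the robot that starts at $s$ and makes $k$ trips, going alternately from $s$ to the wall and from the wall back to $s$; the motion up to any moment depends on $S$ only through the obstacles touched so far, i.e. if the motion in $S$ up to some moment would touch exactly the same obstacles at the same moments in $S'$, then the motion in $S'$ up to that moment is the same. Let $R_i(S)$ be the distance traveled in the $i$-th trip, let $L(S)$ be the (infimal) length of an obstacle-free path from $s$ to the wall, and let $$\rho(R,n,k)=\sup_{S}\frac{\sum_{i=1}^{k}R_i(S)}{k\,L(S)}\in[0,\infty].$$ Then for every real $n$, every integer $k$ with $1\le k\le n$, and every deterministic algorithm $R$ for $k$ trips, $$\rho(R,n,k)\ \ge\ \frac1{12}\sqrt{\frac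 nk}.$$ -/

import Mathlib

open Set

namespace Navigation

/-- The plane, with its Euclidean distance. -/
abbrev Plane := EuclideanSpace ℝ (Fin 2)

/-- An obstacle: an axis-parallel rectangle `[left, right] × [bottom, top]` of width and height at
least 1, the `x`-coordinates of whose corners are integers. -/
structure Obstacle where
  left : ℤ
  right : ℤ
  bottom : ℝ
  top : ℝ
  one_le_width : left + 1 ≤ right
  one_le_height : bottom + 1 ≤ top

/-- The closed rectangle occupied by an obstacle. -/
def Obstacle.body (O : Obstacle) : Set Plane :=
  {p | (O.left : ℝ) ≤ p 0 ∧ p 0 ≤ O.right ∧ O.bottom ≤ p 1 ∧ p 1 ≤ O.top}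

/-- The open rectangle that the robot cannot enter. -/
def Obstacle.inner (O : Obstacle) : Set Plane :=
  {p | (O.left : ℝ) < p 0 ∧ p 0 < O.right ∧ O.bottom < p 1 ∧ p 1 < O.top}

/-- The start point `s`, the origin. -/
def start : Plane := 0

/-- The target `t`: the infinite vertical line `x = n`. -/
def wall (n : ℝ) : Set Plane := {p | p 0 = n}

/-- A scene: a set of non-overlapping obstacles (they may touch), none of which contains the start
point in its interior. -/
structure Scene where
  obstacles : Set Obstacle
  nonoverlapping : obstacles.Pairwise fun O O' => Disjoint O.inner O'.inner
  start_free : ∀ O ∈ obstacles, start ∉ O.inner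

/-- The points where a point robot may be. It can walk along the sides of obstacles, and squeeze
between obstacles that touch. -/
def Scene.free (S : Scene) : Set Plane := {p | ∀ O ∈ S.obstacles, p ∉ O.inner}

/-- The obstacles that a robot located at `p` touches. -/
def Scene.touched (S : Scene) (p : Plane) : Set Obstacle := {O ∈ S.obstacles | p ∈ O.body}

/-- `γ`, on the time interval `[0, 1]`, is an obstacle-free path from the start point to the
wall. -/
structure Scene.IsPathToWall (S : Scene) (n : ℝ) (γ : ℝ → Plane) : Prop where
  continuousOn : ContinuousOn γ (Icc 0 1)
  source : γ 0 = start
  target : γ 1 ∈ wall n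
  free : ∀ t ∈ Icc (0 : ℝ) 1, γ t ∈ S.free

/-- `L(S)`: the length of the shortest obstacle-free path from the start point to the wall. -/
noncomputable def Scene.shortest (S : Scene) (n : ℝ) : ENNReal :=
  ⨅ (γ : ℝ → Plane) (_ : S.IsPathToWall n γ), eVariationOn γ (Icc 0 1)

/-- Where the robot is to be when its first `i` trips are over: it goes back and forth between the
start point and the wall. -/
def goal (n : ℝ) (i : ℕ) : Set Plane := if Even i then {start} else wall n

/-- A deterministic on-line strategy for making `k` trips between the start point and the wall
`x = n`, using tactile sensing only.

`path S` is the motion of the robot in the scene `S`. Time is merely a parameter of the motion: the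
speed is unrestricted and the robot may rest, and the clock is normalised so that the `i`-th trip
takes place during `[i - 1, i]`.

The last field says that the strategy is deterministic and depends on the scene only through what
has been touched so far: if the motion in `S` up to time `T` would have touched exactly the same
obstacles at the same times in the scene `S'`, then the robot is at the same place at time `T` in
`S'`. An obstacle is disclosed entirely as soon as it is touched, so that strategies that are only
told the position of its nearest corner are included. -/
structure Strategy (n : ℝ) (k : ℕ) where
  path : Scene → ℝ → Plane
  continuousOn : ∀ S, ContinuousOn (path S) (Icc 0 k)
  free : ∀ S, ∀ t ∈ Icc (0 : ℝ) k, path S t ∈ S.free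
  goal_mem : ∀ S, ∀ i : ℕ, i ≤ k → path S i ∈ goal n i
  online : ∀ S S' : Scene, ∀ T ∈ Icc (0 : ℝ) k,
    (∀ t ∈ Icc 0 T, S.touched (path S t) = S'.touched (path S t)) → path S' T = path S T

namespace Strategy

variable {n : ℝ} {k : ℕ}

/-- `R_i(S)`: the distance traveled by the robot in the `i`-th trip, `1 ≤ i ≤ k`. -/
noncomputable def tripDist (R : Strategy n k) (S : Scene) (i : ℕ) : ENNReal :=
  eVariationOn (R.path S) (Icc ((i : ℝ) - 1) i)

/-- `R^{(k)}(S)`: the total distance traveled by the robot in the `k` trips. -/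
noncomputable def totalDist (R : Strategy n k) (S : Scene) : ENNReal :=
  ∑ i ∈ Finset.Icc 1 k, R.tripDist S i

/-- `ρ(R, n, k)`: the cumulative `k`-trip competitive ratio, the supremum over all scenes `S` of
`R^{(k)}(S) / (k L(S))`. -/
noncomputable def cumulativeRatio (R : Strategy n k) : ENNReal :=
  ⨆ S : Scene, R.totalDist S / (k * S.shortest n)

end Strategy

end Navigation

/-! The adversary tiles the plane with bricks of width 1 and height `n`, odd columns shifted by half
a brick. In the interior of a column the robot can only be at the joints between bricks, and joints
of adjacent columns differ in height by at least `n / 2`, so every trip costs about `n ^ 2 / 2`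
(`le_eVariationOn_of_trip`).

Let `n * δ` be the length of the whole motion. While its height varies little, the robot cannot
change columns often, so it touches only about `48 * δ` bricks (`exists_finset_touched`). Removing
all the others does not alter the motion (`path_brickScene_eq`), but opens short paths: among `2 *
J` horizontal lines, some line meets few of the remaining bricks, each passed by a detour of `n / 2`
(`shortest_brickScene_le`). With `J` near `√(12 * δ)`, the shortest path is about `2 * n * √(12 *
δ)`. The ratio therefore grows like `√δ / k`, and `δ ≥ k * (n - 2) / 2` gives the order `√(n / k)`.
-/

namespace Navigation

/-! ### Brick walls -/

/-- The height of the lower side of the `j`-th brick in column `i`: odd columns are shifted down by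
half a brick. -/
noncomputable def level (h : ℝ) (i j : ℤ) : ℝ := h * (j - ((i % 2 : ℤ) : ℝ) / 2)

/-- The brick of width `1` and height `h` in column `c.1` and row `c.2`. -/
noncomputable def brick (h : ℝ) (hh : 1 ≤ h) (c : ℤ × ℤ) : Obstacle where
  left := c.1
  right := c.1 + 1
  bottom := level h c.1 c.2
  top := level h c.1 c.2 + h
  one_le_width := le_rfl
  one_le_height := by linarith

theorem level_sub_level (h : ℝ) (i j j' : ℤ) :
    level h i j - level h i j' = h * ((j - j' : ℤ) : ℝ) := by
  unfold level; push_cast; ring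

theorem mem_brick_inner {h : ℝ} {hh : 1 ≤ h} {c : ℤ × ℤ} {p : Plane} :
    p ∈ (brick h hh c).inner ↔
      (c.1 : ℝ) < p 0 ∧ p 0 < c.1 + 1 ∧ level h c.1 c.2 < p 1 ∧ p 1 < level h c.1 c.2 + h := by
  simp [Obstacle.inner, brick]

theorem mem_brick_body {h : ℝ} {hh : 1 ≤ h} {c : ℤ × ℤ} {p : Plane} :
    p ∈ (brick h hh c).body ↔
      (c.1 : ℝ) ≤ p 0 ∧ p 0 ≤ c.1 + 1 ∧ level h c.1 c.2 ≤ p 1 ∧ p 1 ≤ level h c.1 c.2 + h := by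
  simp [Obstacle.body, brick]

theorem brick_inner_disjoint {h : ℝ} (hh : 1 ≤ h) {c d : ℤ × ℤ} (hcd : c ≠ d) :
    Disjoint (brick h hh c).inner (brick h hh d).inner := by
  rw [Set.disjoint_left]
  intro p hp hq
  rw [mem_brick_inner] at hp hq
  obtain ⟨i, j⟩ := c
  obtain ⟨i', j'⟩ := d
  obtain ⟨h1, h2, h3, h4⟩ := hp
  obtain ⟨g1, g2, g3, g4⟩ := hq
  simp only at *
  have hi : i = i' := by
    have a1 : i < i' + 1 := by exact_mod_cast h1.trans g2
    have a2 : i' < i + 1 := by exact_mod_cast g1.trans h2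
    omega
  subst hi
  have hl := level_sub_level h i j j'
  have a1 : ((j - j' : ℤ) : ℝ) < 1 := by
    by_contra! hc
    nlinarith
  have a2 : (-1 : ℝ) < ((j - j' : ℤ) : ℝ) := by
    by_contra! hc
    nlinarith
  have a3 : j - j' < 1 := by exact_mod_cast a1
  have a4 : -1 < j - j' := by exact_mod_cast a2
  exact hcd (by simp; omega)

/-- The scene consisting of the bricks with indices in `F`. -/
noncomputable def brickScene (h : ℝ) (hh : 1 ≤ h) (F : Set (ℤ × ℤ)) : Scene where
  obstacles := brick h hh '' F
  nonoverlapping := by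
    rintro _ ⟨c, -, rfl⟩ _ ⟨d, -, rfl⟩ hne
    exact brick_inner_disjoint hh fun hcd => hne (by rw [hcd])
  start_free := by
    rintro _ ⟨c, -, rfl⟩ hs
    rw [mem_brick_inner] at hs
    obtain ⟨h1, h2, -, -⟩ := hs
    simp only [start, PiLp.zero_apply] at h1 h2
    have a1 : c.1 < 0 := by exact_mod_cast h1
    have a2 : 0 < c.1 + 1 := by exact_mod_cast h2
    omega

theorem mem_free_brickScene {h : ℝ} {hh : 1 ≤ h} {F : Set (ℤ × ℤ)} {p : Plane} :
    p ∈ (brickScene h hh F).free ↔ ∀ c ∈ F, p ∉ (brick h hh c).inner := by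
  simp only [Scene.free, brickScene, mem_ofPred_eq]
  exact forall_mem_image

/-- Inside a column, the robot can only walk between two bricks. -/
theorem exists_eq_level_of_mem_free {h : ℝ} {hh : 1 ≤ h} {p : Plane}
    (hp : p ∈ (brickScene h hh univ).free) {i : ℤ} (h1 : (i : ℝ) < p 0) (h2 : p 0 < i + 1) :
    ∃ j : ℤ, p 1 = level h i j := by
  have hpos : 0 < h := by linarith
  set z : ℝ := p 1 / h + ((i % 2 : ℤ) : ℝ) / 2 with hz
  have hp1 : p 1 = h * (z - ((i % 2 : ℤ) : ℝ) / 2) := by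
    rw [hz]; field_simp; ring
  refine ⟨⌊z⌋, ?_⟩
  have hf := mem_free_brickScene.1 hp (i, ⌊z⌋) (mem_univ _)
  rw [mem_brick_inner] at hf
  have a1 := Int.floor_le z
  have a2 := Int.lt_floor_add_one z
  have a3 : p 1 < level h i ⌊z⌋ + h := by
    unfold level; rw [hp1]; nlinarith
  have a4 : level h i ⌊z⌋ ≤ p 1 := by
    unfold level; rw [hp1]; nlinarith
  by_contra hne
  exact hf ⟨h1, h2, lt_of_le_of_ne a4 fun h' => hne h'.symm, a3⟩

/-- The shift makes the difference an odd multiple of `h / 2`. -/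
theorem half_le_abs_level_sub_level {h : ℝ} (hh : 0 ≤ h) (i j j' : ℤ) :
    h / 2 ≤ |level h i j - level h (i + 1) j'| := by
  have e : level h i j - level h (i + 1) j' =
      h / 2 * ((2 * (j - j') - i % 2 + (i + 1) % 2 : ℤ) : ℝ) := by
    unfold level; push_cast; ring
  rw [e, abs_mul, abs_of_nonneg (by positivity : 0 ≤ h / 2)]
  have : (1 : ℝ) ≤ |((2 * (j - j') - i % 2 + (i + 1) % 2 : ℤ) : ℝ)| := by
    have : (1 : ℤ) ≤ |2 * (j - j') - i % 2 + (i + 1) % 2| := by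
      apply Int.one_le_abs; omega
    exact_mod_cast this
  nlinarith

theorem half_le_abs_sub_of_adjacent_columns {h : ℝ} {hh : 1 ≤ h} {p q : Plane}
    (hp : p ∈ (brickScene h hh univ).free) (hq : q ∈ (brickScene h hh univ).free) {i : ℤ}
    (hp1 : (i : ℝ) < p 0) (hp2 : p 0 < i + 1) (hq1 : (i : ℝ) + 1 < q 0) (hq2 : q 0 < i + 2) :
    h / 2 ≤ |p 1 - q 1| := by
  obtain ⟨j, hj⟩ := exists_eq_level_of_mem_free hp hp1 hp2
  obtain ⟨j', hj'⟩ := exists_eq_level_of_mem_free hq (i := i + 1) (by push_cast; exact hq1)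
    (by push_cast; linarith)
  rw [hj, hj']
  exact half_le_abs_level_sub_level (by linarith) i j j'

theorem abs_coord_sub_le_dist (p q : Plane) (i : Fin 2) : |p i - q i| ≤ dist p q := by
  rw [dist_eq_norm, ← Real.norm_eq_abs]
  exact PiLp.norm_apply_le (p - q) i

theorem ofReal_le_edist_of_le_abs {p q : Plane} {i : Fin 2} {r : ℝ} (h : r ≤ |p i - q i|) :
    ENNReal.ofReal r ≤ edist p q := by
  rw [edist_dist]
  exact ENNReal.ofReal_le_ofReal (h.trans (abs_coord_sub_le_dist p q i))

theorem continuousOn_coord {γ : ℝ → Plane} {s : Set ℝ} (hγ : ContinuousOn γ s) (i : Fin 2) :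
    ContinuousOn (fun t => γ t i) s :=
  (EuclideanSpace.proj (𝕜 := ℝ) i).continuous.comp_continuousOn hγ

/-! ### The length of a trip through the full wall -/

/-- Induction over the columns, sampled at their middles: by continuity the path passes `m + 1 / 2`
before `m + 3 / 2`, and the joints there differ in height by at least `h / 2`. -/
theorem le_eVariationOn_of_reach_column {h : ℝ} {hh : 1 ≤ h} {γ : ℝ → Plane} {a b : ℝ}
    (hc : ContinuousOn γ (Icc a b)) (hf : ∀ t ∈ Icc a b, γ t ∈ (brickScene h hh univ).free)
    (ha : γ a 0 = 0) (m : ℕ) :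
    ∀ t ∈ Icc a b, γ t 0 = m + 1 / 2 →
      ENNReal.ofReal (m * (h / 2)) ≤ eVariationOn γ (Icc a t) := by
  induction m with
  | zero => intro t _ _; simp
  | succ m ih =>
    intro t ht hx
    have hsub : Icc a t ⊆ Icc a b := Icc_subset_Icc_right ht.2
    have := intermediate_value_Icc ht.1 ((continuousOn_coord hc 0).mono hsub)
    obtain ⟨u, hu, hux⟩ := this (show (m : ℝ) + 1 / 2 ∈ _ by
      simp only [ha, hx]; push_cast; constructor
      · positivity
      · linarith)
    have h1 := ih u (hsub hu) hux
    have h2 : ENNReal.ofReal (h / 2) ≤ eVariationOn γ (Icc u t) := by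
      refine le_trans ?_ (eVariationOn.edist_le γ (left_mem_Icc.2 hu.2) (right_mem_Icc.2 hu.2))
      refine ofReal_le_edist_of_le_abs (i := 1) ?_
      push_cast at hx
      refine half_le_abs_sub_of_adjacent_columns (hf u (hsub hu)) (hf t ht) (i := m) ?_ ?_ ?_ ?_ <;>
        simp only [hux, hx] <;> push_cast <;> linarith
    have h3 := eVariationOn.Icc_add_Icc γ (s := univ) hu.1 hu.2 (mem_univ _)
    simp only [univ_inter] at h3
    rw [← h3]
    refine le_trans ?_ (add_le_add h1 h2)
    rw [← ENNReal.ofReal_add (by positivity) (by linarith)]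
    apply ENNReal.ofReal_le_ofReal
    push_cast; linarith

theorem le_eVariationOn_of_trip {h : ℝ} {hh : 1 ≤ h} {γ : ℝ → Plane} {a b n : ℝ} (hab : a ≤ b)
    (hc : ContinuousOn γ (Icc a b)) (hf : ∀ t ∈ Icc a b, γ t ∈ (brickScene h hh univ).free)
    (ha : γ a 0 = 0) (hb : γ b 0 = n) {m : ℕ} (hm : (m : ℝ) + 1 ≤ n) :
    ENNReal.ofReal (m * (h / 2)) ≤ eVariationOn γ (Icc a b) := by
  have := intermediate_value_Icc hab (continuousOn_coord hc 0)
  obtain ⟨u, hu, hux⟩ := this (show (m : ℝ) + 1 / 2 ∈ _ by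
    simp only [ha, hb]; constructor
    · positivity
    · linarith)
  exact (le_eVariationOn_of_reach_column hc hf ha m u hu hux).trans
    (eVariationOn.mono _ (Icc_subset_Icc_right hu.2))

theorem le_eVariationOn_of_return_trip {h : ℝ} {hh : 1 ≤ h} {γ : ℝ → Plane} {a b n : ℝ}
    (hab : a ≤ b)
    (hc : ContinuousOn γ (Icc a b)) (hf : ∀ t ∈ Icc a b, γ t ∈ (brickScene h hh univ).free)
    (ha : γ a 0 = n) (hb : γ b 0 = 0) {m : ℕ} (hm : (m : ℝ) + 1 ≤ n) :
    ENNReal.ofReal (m * (h / 2)) ≤ eVariationOn γ (Icc a b) := by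
  have hmaps : MapsTo (fun t => a + b - t) (Icc a b) (Icc a b) := fun t ht =>
    ⟨by linarith [ht.2], by linarith [ht.1]⟩
  have key := le_eVariationOn_of_trip (γ := γ ∘ fun t => a + b - t) (hh := hh) hab
    (hc.comp (by fun_prop) hmaps) (fun t ht => hf _ (hmaps ht)) (by simpa using hb)
    (by simpa using ha) hm
  refine key.trans (eVariationOn.comp_le_of_antitoneOn γ _ ?_ hmaps)
  intro x _ y _ hxy
  simp only; linarith

/-! ### The number of bricks touched -/

/-- Two heights in the window differ by at most `h / 3 < h / 2`, so the path cannot visit the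
interiors of two adjacent columns. Leaving the stated range would force it to cross two of them. -/
theorem coord_le_of_window {h : ℝ} {hh : 1 ≤ h} {γ : ℝ → Plane} {a b : ℝ}
    (hc : ContinuousOn γ (Icc a b)) (hf : ∀ t ∈ Icc a b, γ t ∈ (brickScene h hh univ).free)
    (hw : ∀ t ∈ Icc a b, |γ t 1 - γ b 1| ≤ h / 6) {u : ℝ} (hu : u ∈ Icc a b) :
    (⌊γ b 0⌋ : ℝ) - 1 ≤ γ u 0 ∧ γ u 0 ≤ ⌊γ b 0⌋ + 1 := by
  have hab : a ≤ b := hu.1.trans hu.2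
  have f1 := Int.floor_le (γ b 0)
  have f2 := Int.lt_floor_add_one (γ b 0)
  have hivt : ∀ z ∈ uIcc (γ u 0) (γ b 0), ∃ t ∈ Icc a b, γ t 0 = z := by
    intro z hz
    have hub : uIcc u b ⊆ Icc a b := by rw [uIcc_of_le hu.2]; exact Icc_subset_Icc_left hu.1
    obtain ⟨t, ht, e⟩ := intermediate_value_uIcc ((continuousOn_coord hc 0).mono hub) hz
    exact ⟨t, hub ht, e⟩
  have hno : ∀ (i : ℤ) (y z : ℝ), y ∈ uIcc (γ u 0) (γ b 0) → z ∈ uIcc (γ u 0) (γ b 0) →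
      (i : ℝ) < y → y < i + 1 → (i : ℝ) + 1 < z → z < i + 2 → False := by
    intro i y z hy hz y1 y2 z1 z2
    obtain ⟨t, ht, rfl⟩ := hivt y hy
    obtain ⟨t', ht', rfl⟩ := hivt z hz
    have k1 := half_le_abs_sub_of_adjacent_columns (hf t ht) (hf t' ht') y1 y2 z1 z2
    have k2 := abs_sub_le (γ t 1) (γ b 1) (γ t' 1)
    have k3 := hw t ht
    have k4 := hw t' ht'
    rw [abs_sub_comm] at k4
    linarith
  set i := ⌊γ b 0⌋
  constructor
  · by_contra! hlt
    have hle : γ u 0 ≤ γ b 0 := by linarith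
    -- The `max` keeps the first point between `γ u 0` and `γ b 0` and inside column `i - 2`, even
    -- when the path starts within that column.
    refine hno (i - 2) (max (γ u 0) (i - 3 / 2)) (i - 1 / 2) ?_ ?_ ?_ ?_ ?_ ?_
    · rw [uIcc_of_le hle]
      exact ⟨le_max_left _ _, max_le hle (by linarith)⟩
    · rw [uIcc_of_le hle]; constructor <;> linarith
    · refine lt_max_of_lt_right ?_; push_cast; linarith
    · refine max_lt ?_ ?_ <;> push_cast <;> linarith
    · push_cast; linarith
    · push_cast; linarith
  · by_contra! hlt
    have hle : γ b 0 ≤ γ u 0 := by linarith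
    refine hno i (max (γ b 0) (i + 1 / 2)) (min (γ u 0) (i + 3 / 2)) ?_ ?_ ?_ ?_ ?_ ?_
    · rw [uIcc_of_ge hle]
      exact ⟨le_max_left _ _, max_le hle (by linarith)⟩
    · rw [uIcc_of_ge hle]
      exact ⟨le_min hle (by linarith), min_le_left _ _⟩
    · refine lt_max_of_lt_right ?_; linarith
    · refine max_lt ?_ ?_ <;> linarith
    · refine lt_min ?_ ?_ <;> linarith
    · refine min_lt_of_right_lt ?_; linarith

/-- A horizontal range of length 2 with integral ends meets 4 closed columns; a vertical range of
length `h / 3` meets at most 2 closed bricks in each. -/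
theorem exists_finset_touched_window {h : ℝ} {hh : 1 ≤ h} {γ : ℝ → Plane} {a b : ℝ}
    (hc : ContinuousOn γ (Icc a b)) (hf : ∀ t ∈ Icc a b, γ t ∈ (brickScene h hh univ).free)
    (hw : ∀ t ∈ Icc a b, |γ t 1 - γ b 1| ≤ h / 6) :
    ∃ F : Finset (ℤ × ℤ), F.card ≤ 8 ∧
      ∀ u ∈ Icc a b, ∀ c : ℤ × ℤ, γ u ∈ (brick h hh c).body → c ∈ F := by
  have hpos : 0 < h := by linarith
  set i := ⌊γ b 0⌋ with hi
  -- The top of the window in row units of column `l`; a touched row `j` satisfies `j ≤ A l < j +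
  -- 2`.
  set A : ℤ → ℝ := fun l => (γ b 1 + h / 6) / h + ((l % 2 : ℤ) : ℝ) / 2 with hA
  refine ⟨(Finset.Icc (i - 2) (i + 1) ×ˢ Finset.Icc (-1 : ℤ) 0).image
    fun p => (p.1, ⌊A p.1⌋ + p.2), ?_, ?_⟩
  · refine Finset.card_image_le.trans ?_
    rw [Finset.card_product]
    simp only [Int.card_Icc]
    have : (i + 1 + 1 - (i - 2)).toNat = 4 := by omega
    rw [this]; rfl
  · rintro u hu ⟨l, j⟩ hb
    rw [mem_brick_body] at hb
    obtain ⟨b1, b2, b3, b4⟩ := hb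
    simp only at b1 b2 b3 b4
    obtain ⟨x1, x2⟩ := coord_le_of_window hc hf hw hu
    rw [← hi] at x1 x2
    obtain ⟨y1, y2⟩ := abs_le.1 (hw u hu)
    have l1 : i - 2 ≤ l := by
      have : (i : ℝ) - 1 ≤ l + 1 := x1.trans b2
      have : i - 1 ≤ l + 1 := by exact_mod_cast this
      omega
    have l2 : l ≤ i + 1 := by
      have : (l : ℝ) ≤ i + 1 := b1.trans x2
      exact_mod_cast this
    have hAl : h * (A l - ((l % 2 : ℤ) : ℝ) / 2) = γ b 1 + h / 6 := by
      simp only [hA]; field_simp; ring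
    unfold level at b3 b4
    have j1 : (j : ℝ) ≤ A l := by
      by_contra! hlt
      nlinarith
    have j2 : A l < j + 2 := by
      by_contra! hlt
      nlinarith
    have j3 : j ≤ ⌊A l⌋ := Int.le_floor.2 j1
    have j4 : ⌊A l⌋ < j + 2 := Int.floor_lt.2 (by push_cast; exact j2)
    rw [Finset.mem_image]
    refine ⟨(l, j - ⌊A l⌋), ?_, ?_⟩
    · simp only [Finset.mem_product, Finset.mem_Icc]
      omega
    · simp

/-- A motion of length less than `(q + 1) * (h / 6)` in the full wall touches at most `8 * (q + 1)`
bricks. -/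
theorem exists_finset_touched {h : ℝ} {hh : 1 ≤ h} {γ : ℝ → Plane} {a : ℝ} (q : ℕ) :
    ∀ b : ℝ, a ≤ b → ContinuousOn γ (Icc a b) →
    (∀ t ∈ Icc a b, γ t ∈ (brickScene h hh univ).free) →
    eVariationOn γ (Icc a b) < ENNReal.ofReal ((q + 1) * (h / 6)) →
    ∃ F : Finset (ℤ × ℤ), F.card ≤ 8 * (q + 1) ∧
      ∀ u ∈ Icc a b, ∀ c : ℤ × ℤ, γ u ∈ (brick h hh c).body → c ∈ F := by
  have hpos : 0 < h := by linarith
  induction q with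
  | zero =>
    intro b hab hc hf hv
    refine exists_finset_touched_window hc hf fun t ht => ?_
    have h1 := eVariationOn.edist_le γ ht (right_mem_Icc.2 hab)
    by_contra! hlt
    have h2 := (ofReal_le_edist_of_le_abs hlt.le).trans h1
    simp at hv
    exact absurd (h2.trans_lt hv) (lt_irrefl _)
  | succ q ih =>
    intro b hab hc hf hv
    by_cases hall : ∀ t ∈ Icc a b, |γ t 1 - γ b 1| ≤ h / 6
    · obtain ⟨F, hF, h2⟩ := exists_finset_touched_window hc hf hall
      exact ⟨F, by omega, h2⟩
    have hcont : ContinuousOn (fun t => |γ t 1 - γ b 1|) (Icc a b) :=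
      ((continuousOn_coord hc 1).sub continuousOn_const).abs
    -- The last time `s` in `B` cuts the motion: `[s, b]` is a single window of length at least `h /
    -- 6`, and the induction hypothesis covers `[a, s]`.
    set B : Set ℝ := {t ∈ Icc a b | h / 6 ≤ |γ t 1 - γ b 1|} with hB
    have hBne : B.Nonempty := by
      push Not at hall
      obtain ⟨t, ht, h'⟩ := hall
      exact ⟨t, ht, h'.le⟩
    have hBcpt : IsCompact B := by
      have : B = Icc a b ∩ (fun t => |γ t 1 - γ b 1|) ⁻¹' Ici (h / 6) := rfl
      rw [this]
      exact isCompact_Icc.of_isClosed_subset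
        (hcont.preimage_isClosed_of_isClosed isClosed_Icc isClosed_Ici) inter_subset_left
    obtain ⟨s, hs, hmax⟩ := hBcpt.exists_isGreatest hBne
    have hsI : s ∈ Icc a b := hs.1
    -- Otherwise continuity would give a time after `s` at which the deviation is exactly `h / 6`.
    have hs6 : |γ s 1 - γ b 1| ≤ h / 6 := by
      by_contra! hlt
      have hz : h / 6 ∈ Icc (|γ b 1 - γ b 1|) (|γ s 1 - γ b 1|) := by
        refine ⟨?_, hlt.le⟩
        simp; positivity
      obtain ⟨t, ht, e⟩ := intermediate_value_Icc' hsI.2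
        (hcont.mono (Icc_subset_Icc_left hsI.1)) hz
      simp only at e
      have : t ≤ s := hmax ⟨⟨hsI.1.trans ht.1, ht.2⟩, e.ge⟩
      have : t = s := le_antisymm this ht.1
      subst this
      linarith
    have hsb : Icc s b ⊆ Icc a b := Icc_subset_Icc_left hsI.1
    obtain ⟨F, hF, hF2⟩ := exists_finset_touched_window (hh := hh) (hc.mono hsb)
      (fun t ht => hf t (hsb ht)) (by
        intro t ht
        rcases ht.1.eq_or_lt with rfl | hlt
        · exact hs6
        · by_contra! hbad
          exact absurd (hmax ⟨hsb ht, hbad.le⟩) (not_le.2 hlt))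
    have has : Icc a s ⊆ Icc a b := Icc_subset_Icc_right hsI.2
    obtain ⟨G, hG, hG2⟩ := ih s hsI.1 (hc.mono has) (fun t ht => hf t (has ht)) (by
      have h1 : ENNReal.ofReal (h / 6) ≤ eVariationOn γ (Icc s b) :=
        (ofReal_le_edist_of_le_abs hs.2).trans
          (eVariationOn.edist_le γ (left_mem_Icc.2 hsI.2) (right_mem_Icc.2 hsI.2))
      have h3 := eVariationOn.Icc_add_Icc γ (s := univ) hsI.1 hsI.2 (mem_univ _)
      simp only [univ_inter] at h3
      rw [← h3] at hv
      have h4 := (add_le_add_right h1 (eVariationOn γ (Icc a s))).trans_lt hv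
      have h5 : ENNReal.ofReal (((q + 1 : ℕ) + 1) * (h / 6)) =
          ENNReal.ofReal ((q + 1) * (h / 6)) + ENNReal.ofReal (h / 6) := by
        rw [← ENNReal.ofReal_add (by positivity) (by positivity)]
        congr 1; push_cast; ring
      rw [h5] at h4
      exact lt_of_add_lt_add_right h4)
    classical
    refine ⟨F ∪ G, (Finset.card_union_le _ _).trans (by omega), ?_⟩
    intro u hu c hcu
    rw [Finset.mem_union]
    rcases le_total u s with hus | hus
    · exact Or.inr (hG2 u ⟨hu.1, hus⟩ c hcu)
    · exact Or.inl (hF2 u ⟨hus, hu.2⟩ c hcu)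

/-! ### Short paths through a finite set of bricks -/

/-- The point `q` can be reached from `p` by an obstacle-free path of length at most `ℓ`. -/
def Scene.Reach (S : Scene) (p q : Plane) (ℓ : ℝ) : Prop :=
  ∃ γ : ℝ → Plane, ContinuousOn γ (Icc 0 1) ∧ γ 0 = p ∧ γ 1 = q ∧
    (∀ t ∈ Icc (0 : ℝ) 1, γ t ∈ S.free) ∧ eVariationOn γ (Icc 0 1) ≤ ENNReal.ofReal ℓ

theorem Scene.Reach.mono {S : Scene} {p q : Plane} {ℓ ℓ' : ℝ} (h : S.Reach p q ℓ) (hl : ℓ ≤ ℓ') :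
    S.Reach p q ℓ' := by
  obtain ⟨γ, h1, h2, h3, h4, h5⟩ := h
  exact ⟨γ, h1, h2, h3, h4, h5.trans (ENNReal.ofReal_le_ofReal hl)⟩

theorem Scene.Reach.trans {S : Scene} {p q r : Plane} {ℓ ℓ' : ℝ} (hl : 0 ≤ ℓ) (hl' : 0 ≤ ℓ')
    (h : S.Reach p q ℓ) (h' : S.Reach q r ℓ') : S.Reach p r (ℓ + ℓ') := by
  obtain ⟨γ, h1, h2, h3, h4, h5⟩ := h
  obtain ⟨δ, g1, g2, g3, g4, g5⟩ := h'
  set η : ℝ → Plane := fun t => if t ≤ 1 / 2 then γ (2 * t) else δ (2 * t - 1) with hη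
  have e1 : EqOn η (γ ∘ fun t => 2 * t) (Icc 0 (1 / 2)) := fun t ht => by
    simp only [hη, if_pos ht.2, Function.comp]
  have e2 : EqOn η (δ ∘ fun t => 2 * t - 1) (Icc (1 / 2) 1) := fun t ht => by
    rcases ht.1.eq_or_lt with rfl | hlt
    · simp only [hη, le_refl, if_true, Function.comp]
      norm_num [h3, g2]
    · simp only [hη, if_neg (not_le.2 hlt), Function.comp]
  have m1 : MapsTo (fun t : ℝ => 2 * t) (Icc 0 (1 / 2)) (Icc 0 1) := fun t ht =>
    ⟨by linarith [ht.1], by linarith [ht.2]⟩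
  have m2 : MapsTo (fun t : ℝ => 2 * t - 1) (Icc (1 / 2) 1) (Icc 0 1) := fun t ht =>
    ⟨by linarith [ht.1], by linarith [ht.2]⟩
  have hu : Icc (0 : ℝ) (1 / 2) ∪ Icc (1 / 2) 1 = Icc 0 1 :=
    Icc_union_Icc_eq_Icc (by norm_num) (by norm_num)
  refine ⟨η, ?_, ?_, ?_, ?_, ?_⟩
  · rw [← hu]
    exact ((h1.comp (by fun_prop) m1).congr e1).union_of_isClosed
      ((g1.comp (by fun_prop) m2).congr e2) isClosed_Icc isClosed_Icc
  · rw [e1 (by norm_num)]; simpa using h2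
  · rw [e2 (by norm_num)]; norm_num [g3]
  · intro t ht
    rw [← hu] at ht
    rcases ht with ht | ht
    · rw [e1 ht]; exact h4 _ (m1 ht)
    · rw [e2 ht]; exact g4 _ (m2 ht)
  · have h6 := eVariationOn.Icc_add_Icc η (s := univ) (show (0 : ℝ) ≤ 1 / 2 by norm_num)
      (show (1 / 2 : ℝ) ≤ 1 by norm_num) (mem_univ _)
    simp only [univ_inter] at h6
    rw [← h6, ENNReal.ofReal_add hl hl', eVariationOn.congr e1, eVariationOn.congr e2]
    refine add_le_add ((eVariationOn.comp_le_of_monotoneOn γ _ ?_ m1).trans h5)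
      ((eVariationOn.comp_le_of_monotoneOn δ _ ?_ m2).trans g5)
    · intro x _ y _ hxy; simp only; linarith
    · intro x _ y _ hxy; simp only; linarith

theorem Scene.reach_segment {S : Scene} {p q : Plane}
    (hf : ∀ t ∈ Icc (0 : ℝ) 1, AffineMap.lineMap p q t ∈ S.free) : S.Reach p q (dist p q) := by
  refine ⟨AffineMap.lineMap p q, AffineMap.lineMap_continuous.continuousOn, by simp, by simp,
    hf, ?_⟩
  have h1 : LipschitzWith (nndist p q) (AffineMap.lineMap p q : ℝ → Plane) :=
    lipschitzWith_lineMap p q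
  have h2 := (h1.lipschitzOnWith (s := univ)).comp_eVariationOn_le (g := (id : ℝ → ℝ))
    (s := Icc 0 1) (fun _ _ => mem_univ _)
  have h3 : eVariationOn (id : ℝ → ℝ) (Icc 0 1) ≤ ENNReal.ofReal (1 - 0) := by
    have := (monotone_id.monotoneOn (univ : Set ℝ)).eVariationOn_eq (mem_univ 0) (mem_univ 1)
    rw [univ_inter] at this
    exact this.le
  rw [Function.comp_id] at h2
  refine h2.trans ((mul_le_mul_right h3 _).trans ?_)
  rw [← edist_dist, edist_nndist]
  simp

theorem dist_vertical (x y y' : ℝ) : dist (!₂[x, y] : Plane) !₂[x, y'] = |y - y'| := by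
  rw [EuclideanSpace.dist_eq]
  simp [Real.sqrt_sq_eq_abs, Real.dist_eq]

theorem dist_horizontal (x x' y : ℝ) : dist (!₂[x, y] : Plane) !₂[x', y] = |x - x'| := by
  rw [EuclideanSpace.dist_eq]
  simp [Real.sqrt_sq_eq_abs, Real.dist_eq]

/-- Integral abscissae never lie inside a brick, so vertical motion there is free for every `F`. -/
theorem reach_vertical {h : ℝ} {hh : 1 ≤ h} {F : Set (ℤ × ℤ)} (i : ℤ) (y y' : ℝ) :
    (brickScene h hh F).Reach !₂[(i : ℝ), y] !₂[(i : ℝ), y'] |y - y'| := by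
  rw [← dist_vertical i]
  refine Scene.reach_segment fun t _ => ?_
  rw [mem_free_brickScene]
  intro c _ hc
  rw [mem_brick_inner] at hc
  obtain ⟨h1, h2, -, -⟩ := hc
  simp [AffineMap.lineMap_apply] at h1 h2
  have a1 : c.1 < i := by exact_mod_cast h1
  have a2 : i < c.1 + 1 := by exact_mod_cast h2
  omega

theorem reach_horizontal {h : ℝ} {hh : 1 ≤ h} {F : Set (ℤ × ℤ)} (i : ℤ) (y : ℝ)
    (hy : ∀ j, (i, j) ∈ F → ¬ (level h i j < y ∧ y < level h i j + h)) :
    (brickScene h hh F).Reach !₂[(i : ℝ), y] !₂[((i + 1 : ℤ) : ℝ), y] 1 := by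
  have e : dist (!₂[(i : ℝ), y] : Plane) !₂[((i + 1 : ℤ) : ℝ), y] = 1 := by
    rw [dist_horizontal]; push_cast; simp
  rw [← e]
  refine Scene.reach_segment fun t ht => ?_
  rw [mem_free_brickScene]
  rintro ⟨l, j⟩ hF hc
  rw [mem_brick_inner] at hc
  obtain ⟨h1, h2, h3, h4⟩ := hc
  simp [AffineMap.lineMap_apply] at h1 h2 h3 h4
  have a1 : l < i + 1 := by
    have : (l : ℝ) < i + 1 := by linarith [ht.2]
    exact_mod_cast this
  have a2 : i < l + 1 := by
    have : (i : ℝ) < l + 1 := by linarith [ht.1]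
    exact_mod_cast this
  obtain rfl : l = i := by omega
  exact hy j hF ⟨h3, h4⟩

/-- The line at a quarter of the height of the bricks in row `j` and even columns, and at three
quarters of the height of those in odd columns. -/
noncomputable def line (h : ℝ) (j : ℤ) : ℝ := h * (j + 1 / 4)

theorem eq_of_line_mem_brick {h : ℝ} (hh : 0 < h) {i j j' : ℤ} (h1 : level h i j' < line h j)
    (h2 : line h j < level h i j' + h) : j' = j := by
  unfold level line at *
  have p : (0 : ℝ) ≤ ((i % 2 : ℤ) : ℝ) := by exact_mod_cast Int.emod_nonneg i two_ne_zero
  have p' : ((i % 2 : ℤ) : ℝ) ≤ 1 := by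
    exact_mod_cast Int.lt_add_one_iff.1 (Int.emod_lt_of_pos i two_pos)
  have a1 : (j' : ℝ) < j + 1 := by
    by_contra! hlt
    nlinarith
  have a2 : (j : ℝ) < j' + 1 := by
    by_contra! hlt
    nlinarith
  have a3 : j' < j + 1 := by exact_mod_cast a1
  have a4 : j < j' + 1 := by exact_mod_cast a2
  omega

theorem exists_level_near_line {h : ℝ} (hh : 0 < h) (i j : ℤ) :
    ∃ r : ℤ, |line h j - level h i r| = h / 4 := by
  unfold level line
  rcases Int.emod_two_eq_zero_or_one i with e | e
  · refine ⟨j, ?_⟩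
    rw [e, abs_of_nonneg] <;> push_cast <;> nlinarith
  · refine ⟨j + 1, ?_⟩
    rw [e, abs_of_nonpos] <;> push_cast <;> nlinarith

/-- Walk `h / 4` to the nearest joint, cross the column along it, and walk back. A joint is free
even in the full wall. -/
theorem reach_detour {h : ℝ} {hh : 1 ≤ h} {F : Set (ℤ × ℤ)} (i j : ℤ) :
    (brickScene h hh F).Reach !₂[(i : ℝ), line h j] !₂[((i + 1 : ℤ) : ℝ), line h j]
      (1 + h / 2) := by
  have hpos : 0 < h := by linarith
  obtain ⟨r, hr⟩ := exists_level_near_line hpos i j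
  have h1 := reach_vertical (hh := hh) (F := F) i (line h j) (level h i r)
  have h2 := reach_horizontal (hh := hh) (F := F) i (level h i r) (by
    rintro j' - ⟨b1, b2⟩
    have := level_sub_level h i r j'
    have a1 : ((r - j' : ℤ) : ℝ) < 1 := by
      by_contra! hlt
      nlinarith
    have a2 : (0 : ℝ) < ((r - j' : ℤ) : ℝ) := by
      by_contra! hlt
      nlinarith
    have a3 : r - j' < 1 := by exact_mod_cast a1
    have a4 : 0 < r - j' := by exact_mod_cast a2
    omega)
  have h3 := reach_vertical (hh := hh) (F := F) (i + 1) (level h i r) (line h j)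
  rw [abs_sub_comm] at h3
  rw [hr] at h1 h3
  refine (((h1.trans (by positivity) zero_le_one h2).trans (by positivity) (by positivity)
    h3)).mono ?_
  linarith

/-- Walking along a line, the robot has to make a detour around each brick that it hits. -/
theorem reach_along_line {h : ℝ} {hh : 1 ≤ h} (F : Finset (ℤ × ℤ)) (j : ℤ) (m : ℕ) :
    (brickScene h hh F).Reach !₂[((0 : ℤ) : ℝ), line h j] !₂[((m : ℤ) : ℝ), line h j]
      (m + ((Finset.range m).filter fun i : ℕ => ((i : ℤ), j) ∈ F).card * (h / 2)) := by
  have hpos : 0 < h := by linarith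
  induction m with
  | zero => simpa using reach_vertical (hh := hh) (F := F) 0 (line h j) (line h j)
  | succ m ih =>
    have step : (brickScene h hh F).Reach !₂[((m : ℤ) : ℝ), line h j]
        !₂[((m + 1 : ℤ) : ℝ), line h j] (1 + (if ((m : ℤ), j) ∈ F then 1 else 0) * (h / 2)) := by
      split_ifs with hm
      · simpa using reach_detour (hh := hh) (F := F) m j
      · have := reach_horizontal (hh := hh) (F := F) m (line h j) (by
          rintro j' hj' ⟨b1, b2⟩
          rw [eq_of_line_mem_brick hpos b1 b2] at hj'
          exact hm hj')
        simpa using this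
    refine ((ih.trans (by positivity) (by split_ifs <;> positivity) step)).mono (le_of_eq ?_)
    rw [Finset.range_add_one, Finset.filter_insert]
    split_ifs with hm
    · rw [Finset.card_insert_of_notMem (by simp)]
      push_cast; ring
    · push_cast; ring

/-- A path that goes beyond the wall contains a path to the wall. -/
theorem Scene.Reach.shortest_le {S : Scene} {q : Plane} {ℓ n : ℝ} (h : S.Reach start q ℓ)
    (hn : 0 ≤ n) (hq : n ≤ q 0) : S.shortest n ≤ ENNReal.ofReal ℓ := by
  obtain ⟨γ, h1, h2, h3, h4, h5⟩ := h
  obtain ⟨τ, hτ, e⟩ := intermediate_value_Icc zero_le_one (continuousOn_coord h1 0)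
    (show n ∈ _ by simp only [h2, h3]; exact ⟨by simpa [start] using hn, hq⟩)
  have hm : MapsTo (fun t : ℝ => τ * t) (Icc 0 1) (Icc 0 1) := fun t ht =>
    ⟨mul_nonneg hτ.1 ht.1, mul_le_one₀ hτ.2 ht.1 ht.2⟩
  refine (iInf₂_le (γ ∘ fun t => τ * t) ⟨h1.comp (by fun_prop) hm, by simpa using h2, ?_,
    fun t ht => h4 _ (hm ht)⟩).trans ((eVariationOn.comp_le_of_monotoneOn γ _ ?_ hm).trans h5)
  · intro x _ y _ hxy
    exact mul_le_mul_of_nonneg_left hxy hτ.1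
  · simpa [wall] using e

theorem start_eq : start = !₂[((0 : ℤ) : ℝ), 0] := by
  ext i
  fin_cases i <;> simp [start]

theorem shortest_brickScene_le_of_line {h : ℝ} {hh : 1 ≤ h} (F : Finset (ℤ × ℤ)) (j : ℤ) {n : ℝ}
    (hn : 0 ≤ n) :
    (brickScene h hh F).shortest n ≤ ENNReal.ofReal (|line h j| + (n + 1 +
      ((Finset.range (⌊n⌋₊ + 1)).filter fun i : ℕ => ((i : ℤ), j) ∈ F).card * (h / 2))) := by
  have hpos : 0 < h := by linarith
  have h1 := reach_vertical (hh := hh) (F := F) 0 0 (line h j)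
  rw [← start_eq] at h1
  have h2 := h1.trans (abs_nonneg _) (by positivity) (reach_along_line (hh := hh) F j (⌊n⌋₊ + 1))
  refine (h2.mono ?_).shortest_le hn ?_
  · have := Nat.floor_le hn
    simp only [zero_sub, abs_neg]; push_cast; linarith
  · have := (Nat.lt_floor_add_one n).le
    simpa using this

/-- Detours in every column suffice, also for infinite `F`; this serves strategies whose motion in
the full wall has infinite length. -/
theorem shortest_brickScene_ne_top {h : ℝ} {hh : 1 ≤ h} (F : Set (ℤ × ℤ)) {n : ℝ} (hn : 0 ≤ n) :
    (brickScene h hh F).shortest n ≠ ⊤ := by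
  have hpos : 0 < h := by linarith
  have key : ∀ m : ℕ, (brickScene h hh F).Reach !₂[((0 : ℤ) : ℝ), line h 0]
      !₂[((m : ℤ) : ℝ), line h 0] (m * (1 + h / 2)) := by
    intro m
    induction m with
    | zero => simpa using reach_vertical (hh := hh) (F := F) 0 (line h 0) (line h 0)
    | succ m ih =>
      refine (ih.trans (by positivity) (by positivity) (reach_detour m 0)).mono (le_of_eq ?_)
      push_cast; ring
  have h1 := reach_vertical (hh := hh) (F := F) 0 0 (line h 0)
  rw [← start_eq] at h1
  have h2 := h1.trans (abs_nonneg _) (by positivity) (key (⌊n⌋₊ + 1))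
  refine ne_top_of_le_ne_top ENNReal.ofReal_ne_top (h2.shortest_le hn ?_)
  simpa using (Nat.lt_floor_add_one n).le

/-- Distinct lines meet disjoint sets of bricks, so one of the `2 * J` lines meets at most `F.card /
(2 * J)`; each brick costs `h / 2`, and reaching the line costs at most `h * J`. -/
theorem shortest_brickScene_le {h : ℝ} {hh : 1 ≤ h} (F : Finset (ℤ × ℤ)) {n : ℝ} (hn : 0 ≤ n)
    {J : ℕ} (hJ : 0 < J) :
    (brickScene h hh F).shortest n ≤
      ENNReal.ofReal (h * J + (F.card : ℝ) / (4 * J) * h + n + 1) := by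
  have hpos : 0 < h := by linarith
  set c : ℤ → ℕ := fun j =>
    ((Finset.range (⌊n⌋₊ + 1)).filter fun i : ℕ => ((i : ℤ), j) ∈ F).card with hc
  have hsum : ∑ j ∈ Finset.Ico (-J : ℤ) J, c j ≤ F.card := by
    simp only [hc]
    rw [← Finset.card_sigma]
    refine Finset.card_le_card_of_injOn (fun p => ((p.2 : ℤ), p.1)) ?_ ?_
    · rintro ⟨j, i⟩ hp
      simp at hp
      exact hp.2.2
    · rintro ⟨j, i⟩ - ⟨j', i'⟩ - e
      simp at e
      obtain ⟨rfl, rfl⟩ := e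
      rfl
  obtain ⟨j, hj, hle⟩ : ∃ j ∈ Finset.Ico (-J : ℤ) J, (2 * J) * c j ≤ F.card := by
    by_contra! hlt
    have := Finset.sum_lt_sum_of_nonempty (s := Finset.Ico (-J : ℤ) J)
      (by simp; omega) hlt
    rw [Finset.sum_const, ← Finset.mul_sum, Int.card_Ico, smul_eq_mul] at this
    have e : ((J : ℤ) - -J).toNat = 2 * J := by omega
    rw [e] at this
    have := lt_of_mul_lt_mul_left this (by omega)
    omega
  refine (shortest_brickScene_le_of_line F j hn).trans (ENNReal.ofReal_le_ofReal ?_)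
  rw [Finset.mem_Ico] at hj
  have hj1 : (-J : ℝ) ≤ j := by exact_mod_cast hj.1
  have hj2 : (j : ℝ) + 1 ≤ J := by exact_mod_cast hj.2
  have hJr : (0 : ℝ) < J := by exact_mod_cast hJ
  have hl : |line h j| ≤ h * J := by
    unfold line
    rw [abs_le]
    constructor <;> nlinarith
  have hcj : (c j : ℝ) * (h / 2) ≤ F.card / (4 * J) * h := by
    have : (2 * J * c j : ℝ) ≤ F.card := by exact_mod_cast hle
    rw [div_mul_eq_mul_div, le_div_iff₀ (by positivity)]
    nlinarith
  change |line h j| + (n + 1 + (c j : ℝ) * (h / 2)) ≤ _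
  linarith

namespace Strategy

variable {n : ℝ} {k : ℕ}

/-! ### The motion in a brick wall -/

theorem totalDist_eq_eVariationOn (R : Strategy n k) (S : Scene) :
    R.totalDist S = eVariationOn (R.path S) (Icc 0 k) := by
  have h := eVariationOn.sum' (R.path S) (I := fun i : ℕ => (i : ℝ)) Nat.mono_cast (n := k)
  rw [Nat.cast_zero] at h
  rw [← h, totalDist, ← Finset.Ico_add_one_right_eq_Icc, Finset.sum_Ico_eq_sum_range,
    Nat.add_sub_cancel]
  refine Finset.sum_congr rfl fun i _ => ?_
  rw [tripDist, add_comm 1 i]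
  push_cast
  rw [add_sub_cancel_right]

theorem coord_trip_endpoints (R : Strategy n k) (S : Scene) {i : ℕ} (hi : i < k) :
    (R.path S i 0 = 0 ∧ R.path S (i + 1) 0 = n) ∨ (R.path S i 0 = n ∧ R.path S (i + 1) 0 = 0) := by
  have h1 := R.goal_mem S i hi.le
  have h2 := R.goal_mem S (i + 1) hi
  push_cast at h2
  unfold goal at h1 h2
  by_cases he : Even i
  · rw [if_pos he] at h1
    rw [if_neg (by simpa [Nat.even_add_one] using he)] at h2
    refine Or.inl ⟨?_, h2⟩
    rw [mem_singleton_iff.1 h1]; rfl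
  · rw [if_neg he] at h1
    rw [if_pos (by simpa [Nat.even_add_one] using he)] at h2
    refine Or.inr ⟨h1, ?_⟩
    rw [mem_singleton_iff.1 h2]; rfl

theorem trip_subset {i : ℕ} (hi : i < k) : Icc (i : ℝ) (i + 1) ⊆ Icc 0 k :=
  Icc_subset_Icc (Nat.cast_nonneg i) (by exact_mod_cast hi)

theorem mul_le_totalDist (R : Strategy n k) (S : Scene) {r : ENNReal}
    (hr : ∀ i < k, r ≤ eVariationOn (R.path S) (Icc i (i + 1))) : k * r ≤ R.totalDist S := by
  have : (Finset.Icc 1 k).card • r ≤ R.totalDist S := by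
    refine Finset.card_nsmul_le_sum _ _ _ fun i hi => ?_
    rw [Finset.mem_Icc] at hi
    obtain ⟨i, rfl⟩ := Nat.exists_eq_add_of_le' hi.1
    have := hr i (by omega)
    rw [tripDist]
    push_cast
    rwa [add_sub_cancel_right]
  simpa using this

theorem mul_ofReal_le_totalDist (R : Strategy n k) (hn : 0 ≤ n) (S : Scene) :
    k * ENNReal.ofReal n ≤ R.totalDist S := by
  refine R.mul_le_totalDist S fun i hi => ?_
  refine le_trans ?_ (eVariationOn.edist_le (R.path S)
    (left_mem_Icc.2 (by linarith)) (right_mem_Icc.2 (by linarith)))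
  refine ofReal_le_edist_of_le_abs (i := 0) ?_
  rcases R.coord_trip_endpoints S hi with ⟨h1, h2⟩ | ⟨h1, h2⟩ <;> rw [h1, h2] <;>
    simp [abs_of_nonneg hn]

theorem le_totalDist_wall (R : Strategy n k) {h : ℝ} {hh : 1 ≤ h} {m : ℕ} (hm : (m : ℝ) + 1 ≤ n) :
    ENNReal.ofReal (k * (m * (h / 2))) ≤ R.totalDist (brickScene h hh univ) := by
  rw [ENNReal.ofReal_mul (Nat.cast_nonneg k), ENNReal.ofReal_natCast]
  refine R.mul_le_totalDist _ fun i hi => ?_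
  have hc := (R.continuousOn (brickScene h hh univ)).mono (trip_subset hi)
  have hf : ∀ t ∈ Icc (i : ℝ) (i + 1), _ := fun t ht =>
    R.free (brickScene h hh univ) t (trip_subset hi ht)
  rcases R.coord_trip_endpoints (brickScene h hh univ) hi with ⟨h1, h2⟩ | ⟨h1, h2⟩
  · exact le_eVariationOn_of_trip (by linarith) hc hf h1 h2 hm
  · exact le_eVariationOn_of_return_trip (by linarith) hc hf h1 h2 hm

/-- The strategy moves in the same way if the bricks that it does not touch are removed. -/
theorem path_brickScene_eq (R : Strategy n k) {h : ℝ} {hh : 1 ≤ h} {F : Set (ℤ × ℤ)}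
    (hF : ∀ t ∈ Icc (0 : ℝ) k, ∀ c, R.path (brickScene h hh univ) t ∈ (brick h hh c).body → c ∈ F) :
    EqOn (R.path (brickScene h hh F)) (R.path (brickScene h hh univ)) (Icc 0 k) := by
  intro T hT
  refine R.online _ _ T hT fun t ht => ?_
  ext O
  constructor
  · rintro ⟨⟨c, -, rfl⟩, hO⟩
    exact ⟨⟨c, hF t ⟨ht.1, ht.2.trans hT.2⟩ c hO, rfl⟩, hO⟩
  · rintro ⟨⟨c, -, rfl⟩, hO⟩
    exact ⟨⟨c, mem_univ c, rfl⟩, hO⟩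

theorem div_le_cumulativeRatio (R : Strategy n k) (S : Scene) :
    R.totalDist S / (k * S.shortest n) ≤ R.cumulativeRatio :=
  le_iSup (fun S : Scene => R.totalDist S / (k * S.shortest n)) S

end Strategy

/-! ### The ratio for small and for large `n / k` -/

theorem shortest_empty_le {n h : ℝ} {hh : 1 ≤ h} (hn : 0 ≤ n) :
    (brickScene h hh ∅).shortest n ≤ ENNReal.ofReal n := by
  have e : dist start (!₂[n, 0] : Plane) = n := by
    rw [start_eq, dist_horizontal]; simp [abs_of_nonneg hn]
  have := Scene.reach_segment (S := brickScene h hh ∅) (p := start) (q := !₂[n, 0])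
    (fun t _ => by rw [mem_free_brickScene]; simp)
  rw [e] at this
  exact this.shortest_le hn (by simp)

theorem one_le_cumulativeRatio {n : ℝ} {k : ℕ} (hk : 1 ≤ k) (hn : 0 < n) (R : Strategy n k) :
    1 ≤ R.cumulativeRatio := by
  refine le_trans ?_ (R.div_le_cumulativeRatio (brickScene 1 le_rfl ∅))
  have h1 := R.mul_ofReal_le_totalDist hn.le (brickScene 1 le_rfl ∅)
  have hpos : (k : ENNReal) * ENNReal.ofReal n ≠ 0 :=
    mul_ne_zero (by simp; omega) (by simpa using hn)
  have htop : (k : ENNReal) * ENNReal.ofReal n ≠ ⊤ :=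
    ENNReal.mul_ne_top (by simp) ENNReal.ofReal_ne_top
  rw [← ENNReal.div_self hpos htop]
  exact ENNReal.div_le_div h1 (mul_le_mul_right (shortest_empty_le hn.le) _)

/-- In a wall of bricks of height `n`, a motion of total length `n * δ` yields the bound. -/
theorem sqrt_mul_le_of_long_motion {n k δ J C : ℝ} (hk : 1 ≤ k) (hn : 144 * k ≤ n)
    (hδ : k * (n - 2) / 2 ≤ δ) (hJ : √(12 * δ) ≤ J) (hJ' : J ≤ √(12 * δ) + 1)
    (hC : C ≤ 48 * δ + 8) :
    1 / 12 * √(n / k) * (k * (n * J + C / (4 * J) * n + n + 1)) ≤ n * δ := by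
  have hn1 : 144 ≤ n := by linarith
  have hδ0 : 71 ≤ δ := by nlinarith
  set s := √(12 * δ) with hs
  have hs2 : s ^ 2 = 12 * δ := Real.sq_sqrt (by linarith)
  have hs0 : 0 ≤ s := Real.sqrt_nonneg _
  have hs10 : 10 ≤ s := by nlinarith
  have hJ0 : 0 < J := by linarith
  set w := √(n / k) * k with hw
  have hw0 : 0 ≤ w := by positivity
  have hw2 : w ^ 2 = n * k := by
    rw [hw, mul_pow, Real.sq_sqrt (by positivity)]
    field_simp
  -- Here `w ^ 2 = n * k`, while `s ^ 2 = 12 * δ ≥ 6 * k * (n - 2)`; the factor `5 / 12` works as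
  -- soon as `n ≥ 50`.
  have hws : w ≤ 5 / 12 * s := by
    refine abs_le_of_sq_le_sq' ?_ (by positivity) |>.2
    rw [hw2, mul_pow, hs2]
    nlinarith
  have hCJ : C / (4 * J) ≤ s + 1 := by
    rw [div_le_iff₀ (by positivity)]
    nlinarith
  have hL : n * J + C / (4 * J) * n + n + 1 ≤ n * (2 * s + 4) := by nlinarith
  calc 1 / 12 * √(n / k) * (k * (n * J + C / (4 * J) * n + n + 1))
      = 1 / 12 * w * (n * J + C / (4 * J) * n + n + 1) := by rw [hw]; ring
    _ ≤ 1 / 12 * w * (n * (2 * s + 4)) := by gcongr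
    _ = n / 12 * (w * (2 * s + 4)) := by ring
    _ ≤ n / 12 * (5 / 12 * s * (2 * s + 4)) := by gcongr
    -- Equivalent to `s ≥ 10` for positive `s`; this is where `144 * k ≤ n` leaves room for the
    -- lower-order terms.
    _ ≤ n / 12 * s ^ 2 := by gcongr; nlinarith
    _ = n * δ := by rw [hs2]; ring

theorem le_cumulativeRatio_of_large {n : ℝ} {k : ℕ} (hk : 1 ≤ k) (hn : 144 * (k : ℝ) ≤ n)
    (R : Strategy n k) : ENNReal.ofReal (1 / 12 * √(n / k)) ≤ R.cumulativeRatio := by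
  have hk1 : (1 : ℝ) ≤ k := by exact_mod_cast hk
  have hn1 : 1 ≤ n := by linarith
  have hn0 : 0 < n := by linarith
  set W := brickScene n hn1 univ with hW
  have hm1 : 1 ≤ ⌊n⌋₊ := Nat.le_floor (by simpa using hn1)
  have hm : ((⌊n⌋₊ - 1 : ℕ) : ℝ) + 1 ≤ n := by
    rw [Nat.cast_sub hm1, Nat.cast_one]
    linarith [Nat.floor_le hn0.le]
  have hm' : n - 2 ≤ ((⌊n⌋₊ - 1 : ℕ) : ℝ) := by
    rw [Nat.cast_sub hm1, Nat.cast_one]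
    linarith [Nat.lt_floor_add_one n]
  have hlow := R.le_totalDist_wall (hh := hn1) hm
  rw [← hW] at hlow
  by_cases htop : R.totalDist W = ⊤
  · refine le_trans ?_ (R.div_le_cumulativeRatio W)
    rw [htop, ENNReal.top_div_of_ne_top
      (ENNReal.mul_ne_top (by simp) (shortest_brickScene_ne_top univ hn0.le))]
    exact le_top
  set δ := (R.totalDist W).toReal / n with hδ
  have hnδ : n * δ = (R.totalDist W).toReal := by rw [hδ]; field_simp
  have hD : R.totalDist W = ENNReal.ofReal (n * δ) := by rw [hnδ, ENNReal.ofReal_toReal htop]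
  have hδlow : k * (n - 2) / 2 ≤ δ := by
    have h1 := (ENNReal.ofReal_le_iff_le_toReal htop).1 hlow
    rw [← hnδ] at h1
    have h2 : k * ((⌊n⌋₊ - 1 : ℕ) * (1 / 2 : ℝ)) ≤ δ := by
      refine le_of_mul_le_mul_left ?_ hn0
      linarith
    have h3 := mul_le_mul_of_nonneg_left hm' (by positivity : (0 : ℝ) ≤ k)
    linarith
  have hδ0 : 0 < δ := by nlinarith
  -- A length `n * δ` is `6 * δ` pieces of length `h / 6` with `h = n`.
  obtain ⟨F, hFcard, hF⟩ := exists_finset_touched (hh := hn1) (γ := R.path W) (a := 0) ⌊6 * δ⌋₊ k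
    (by positivity) (R.continuousOn W) (R.free W) (by
      rw [← R.totalDist_eq_eVariationOn, hD]
      refine (ENNReal.ofReal_lt_ofReal_iff (by positivity)).2 ?_
      have := Nat.lt_floor_add_one (6 * δ)
      nlinarith)
  have hC : (F.card : ℝ) ≤ 48 * δ + 8 := by
    have h1 : (F.card : ℝ) ≤ 8 * (⌊6 * δ⌋₊ + 1) := by exact_mod_cast hFcard
    linarith [Nat.floor_le (by positivity : 0 ≤ 6 * δ)]
  have heq : R.totalDist (brickScene n hn1 F) = ENNReal.ofReal (n * δ) := by
    rw [← hD, R.totalDist_eq_eVariationOn, R.totalDist_eq_eVariationOn]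
    exact eVariationOn.congr (R.path_brickScene_eq fun t ht c hc => hF t ht c hc)
  refine le_trans ?_ (R.div_le_cumulativeRatio (brickScene n hn1 F))
  have hpos : 0 < n * δ := by positivity
  rw [heq, ENNReal.le_div_iff_mul_le (Or.inr (ENNReal.ofReal_pos.2 hpos).ne')
    (Or.inr ENNReal.ofReal_ne_top)]
  -- This choice of `J` balances `n * J` against the detours, about `12 * δ * n / J`.
  have hJ : 0 < ⌈√(12 * δ)⌉₊ := Nat.ceil_pos.2
    (Real.sqrt_pos.2 (mul_pos (by norm_num) hδ0))
  refine (mul_le_mul_right (mul_le_mul_right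
    (shortest_brickScene_le F hn0.le hJ) _) _).trans ?_
  rw [← ENNReal.ofReal_natCast, ← ENNReal.ofReal_mul (by positivity),
    ← ENNReal.ofReal_mul (by positivity)]
  exact ENNReal.ofReal_le_ofReal (sqrt_mul_le_of_long_motion hk1 hn hδlow (Nat.le_ceil _)
    (Nat.ceil_lt_add_one (by positivity)).le hC)

end Navigation

theorem theorem1 (n : ℝ) (k : ℕ) (hk : 1 ≤ k) (hkn : (k : ℝ) ≤ n)
    (R : Navigation.Strategy n k) :
    ENNReal.ofReal (1 / 12 * Real.sqrt (n / k)) ≤ R.cumulativeRatio := by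
  have hk1 : (1 : ℝ) ≤ k := by exact_mod_cast hk
  -- For `n ≤ 144 * k` the claimed bound is at most 1, and the empty scene suffices.
  rcases le_total (144 * (k : ℝ)) n with hn | hn
  · exact Navigation.le_cumulativeRatio_of_large hk hn R
  · refine le_trans ?_ (Navigation.one_le_cumulativeRatio hk (by linarith) R)
    rw [ENNReal.ofReal_le_one]
    have : √(n / k) ≤ 12 := by
      rw [Real.sqrt_le_left (by norm_num), div_le_iff₀ (by linarith)]
      linarith
    linarith
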